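/- **Definitions.** A *sequential cascade* is a tree $V$ (ordered by $\sqsubseteq$) with a least element $\emptyset_V$ and without infinite branches, in which every non-maximal element $v$ has a countably infinite set $v^+$ of immediate successors; $\max V$ is the set of maximal elements, always a subset of $\omega$ here. The rank is defined by $r_V(v)=0$ for $v\in\max V$, and otherwise $r_V(v)$ is the least ordinal greater than the ranks of all elements of $v^+$; $r(V)=r_V(\emptyset_V)$. The cascade is *monotone* if every $v^+$ ($v\notin\max V$) can be enumerated in order type $\omega$ as $(v_k)_{k<\omega}$ so that $(r_V(v_k))_{k<\omega}$ is non-decreasing; such an enumeration is fixed as part of a monotone sequential cascade, and it induces the lexicographic order on $\max V$. For $U\subset\max V$ let $\mathrm{ot}_V(U)$ be the order type of $U$ in this (well-)order. For $v\in V$, $v^{\uparrow}$ is the subcascade $\{v'\in V: v\sqsubseteq v'\}$. The *contour* $\int V$ is the trace on $\max V$ of the neighbourhood filter of $\emptyset_V$ in the finest topology on $V$ for which the cofinite filter on $v^+$ converges to $v$ for every $v\in V\setminus\max V$. A filter on a subset of $\omega$ is identified with the filter on $\omega$ that it generates. For an ordinal $\alpha$ let $\mathrm{indec}(\alpha)$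 be the biggest additively indecomposable ordinal $\le\alpha$ (with $\mathrm{indec}(0)=0$). For monotone sequential cascades write $T\Rrightarrow V$ if $\max T\subset\max V$ and $\mathrm{ot}_T(U)\ge\mathrm{indec}(\mathrm{ot}_V(U))$ for every $U\subset\max T$. Let $u$ be an ultrafilter on $\omega$ with $\int V\subset u$, $\int W\subset u$. *Rank $\alpha$ in $V$ agrees with rank $\beta$ in $W$ with respect to $u$*, written $\alpha_V E_u \beta_W$, if for every choice of sets $\tilde V_{p,s}\in\int p^{\uparrow}$ and $\tilde W_{p,s}\in\int s^{\uparrow}$, for all $p\in V$ with $r_V(p)=\alpha$ and all $s\in W$ with $r_W(s)=\beta$, the union over all these pairs $\bigcup_{(p,s)}(\tilde V_{p,s}\cap\tilde W_{p,s})$ belongs to $u$. **Theorem.** Let $u$ be an ultrafilter on $\omega$ and let $V,W$ be monotone sequential cascades of finite rank with $\max V,\max W\subset\omega$, $\int V\subset u$ and $\int W\subset u$. Let $n,m$ be natural numbers such that $n_V E_u m_W$. Then there is a monotone sequential cascade $T$ with $\max T\subset\omega$ such that $$\max\{r(V),r(W)\}\le r(T)\le r(V)+r(W),$$ and $\int T\subset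 u$, $T\Rrightarrow V$, $T\Rrightarrow W$, $\int V\subset\int T$ and $\int W\subset\int T$. -/

import Mathlib

open Filter Topology

/-- A well-founded, everywhere infinitely branching tree in which the immediate successors of each
non-maximal element carry a fixed order of type `ω`, and whose maximal elements are labelled by
elements of `X`: it is a single maximal element, or a root with the sequence `c 0, c 1, c 2, …` of
subtrees above its immediate successors. Together with injectivity of the labelling
(see `IsMonotoneSequentialCascade`) this is a sequential cascade whose set of maximal elements
is a subset of `X`. -/
inductive SeqTree (X : Type) : Type where
  | leaf (x : X) : SeqTree X
  | node (c : ℕ → SeqTree X) : SeqTree X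

namespace SeqTree

variable {X : Type}

/-- The subtree reached from the root by following a finite sequence of natural numbers, if the
sequence does not leave the tree. -/
def sub : SeqTree X → List ℕ → Option (SeqTree X)
  | t, [] => some t
  | leaf _, _ :: _ => none
  | node c, n :: l => sub (c n) l

/-- The elements `v_l` of the tree, each given by the finite sequence `l` that names it. -/
def Node (V : SeqTree X) : Type := {l : List ℕ // (V.sub l).isSome}

/-- The least element. -/
def root (V : SeqTree X) : V.Node := ⟨[], by cases V <;> rfl⟩

/-- The set of immediate successors of `v`. -/
def succs {V : SeqTree X} (v : V.Node) : Set V.Node := {w | ∃ n : ℕ, w.1 = v.1 ++ [n]}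

/-- The subtree built of `v` and everything above it. -/
def up {V : SeqTree X} (v : V.Node) : SeqTree X := (V.sub v.1).get v.2

/-- The rank of a tree (of its root): `0` if the root is maximal, otherwise the least ordinal
greater than the ranks of all the immediate successors of the root. -/
noncomputable def rank : SeqTree X → Ordinal.{0}
  | leaf _ => 0
  | node c => ⨆ n, Order.succ (rank (c n))

/-- The maximal elements, as pairs of a position and the label at that position. -/
def MaxNode (V : SeqTree X) : Type := {p : List ℕ × X // V.sub p.1 = some (leaf p.2)}

/-- A maximal element as an element of the tree. -/
def MaxNode.toNode {V : SeqTree X} (p : V.MaxNode) : V.Node := ⟨p.1.1, by rw [p.2]; rfl⟩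

/-- The label of a maximal element. -/
def MaxNode.label {V : SeqTree X} (p : V.MaxNode) : X := p.1.2

/-- `max V`, as a subset of `X`. -/
def maxSet (V : SeqTree X) : Set X := Set.range (MaxNode.label (V := V))

/-- Monotone sequential cascades with set of maximal elements contained in `X`: different maximal
elements are different elements of `X`, and the ranks of the successors `v_0, v_1, v_2, …` of each
non-maximal `v` form a non-decreasing sequence. -/
structure IsMonotoneSequentialCascade (V : SeqTree X) : Prop where
  label_injective : Function.Injective (MaxNode.label (V := V))
  monotone_rank : ∀ (v : V.Node) (c : ℕ → SeqTree X), up v = node c →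
    Monotone fun n => rank (c n)

/-- A set is open iff with each of its elements `v` it contains all but finitely many immediate
successors of `v`. By `isLeast_nodeTopology` this is the finest topology for which the cofinite
filter on the set of immediate successors of `v` converges to `v`, for each non-maximal `v`. -/
instance nodeTopology (V : SeqTree X) : TopologicalSpace V.Node where
  IsOpen O := ∀ v ∈ O, (succs v \ O).Finite
  isOpen_univ := fun v _ => by simp
  isOpen_inter := fun s t hs ht v hv => by
    rw [Set.sdiff_inter]
    exact (hs v hv.1).union (ht v hv.2)
  isOpen_sUnion := fun S hS v ⟨s, hs, hv⟩ =>
    (hS s hs v hv).subset (Set.sdiff_subset_sdiff_right (Set.subset_sUnion_of_mem hs))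

theorem isLeast_nodeTopology (V : SeqTree X) :
    IsLeast {t : TopologicalSpace V.Node |
      ∀ v : V.Node, (succs v).Nonempty → cofinite ⊓ 𝓟 (succs v) ≤ @nhds _ t v}
      (nodeTopology V) := by
  have key : ∀ (v : V.Node) (O : Set V.Node),
      O ∈ cofinite ⊓ 𝓟 (succs v) ↔ (succs v \ O).Finite := by
    intro v O
    rw [mem_inf_principal, mem_cofinite]
    have : {x | x ∈ succs v → x ∈ O}ᶜ = succs v \ O := by
      ext x; simp
    rw [this]
  constructor
  · intro v _ N hN
    obtain ⟨O, hON, hO, hvO⟩ := mem_nhds_iff.1 hN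
    exact mem_of_superset ((key v O).2 (hO v hvO)) hON
  · intro t ht O hO v hv
    rcases (succs v).eq_empty_or_nonempty with h | h
    · simp [h]
    · have hN : O ∈ @nhds V.Node t v := @IsOpen.mem_nhds V.Node t v O hO hv
      exact (key v O).1 (ht v h hN)

/-- The contour: the trace on `max V` of the neighbourhood filter of the root, regarded as
(the base of) a filter on `X`. -/
def contour (V : SeqTree X) : Filter X :=
  map (MaxNode.label (V := V)) (comap MaxNode.toNode (𝓝 V.root))

/-- The lexicographic order on maximal elements. (No maximal element is below another one, so two
different maximal elements are compared at the first place where their sequences differ.) -/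
def lexLT (V : SeqTree X) (p q : V.MaxNode) : Prop := p.1.1 < q.1.1

theorem exists_lex_min (V : SeqTree X) : ∀ S : Set (List ℕ),
    (∀ l ∈ S, ∃ x, V.sub l = some (leaf x)) → S.Nonempty → ∃ a ∈ S, ∀ b ∈ S, ¬ b < a := by
  induction V with
  | leaf y =>
    rintro S hS ⟨a, ha⟩
    refine ⟨a, ha, fun b _ hlt => ?_⟩
    obtain ⟨x, hx⟩ := hS a ha
    cases a with
    | nil => exact absurd hlt (List.not_lt_nil b)
    | cons n l => simp [sub] at hx
  | node c ih =>
    rintro S hS hne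
    have hcons : ∀ l ∈ S, ∃ n l', l = n :: l' := by
      intro l hl
      obtain ⟨x, hx⟩ := hS l hl
      cases l with
      | nil => simp [sub] at hx
      | cons n l' => exact ⟨n, l', rfl⟩
    classical
    have hex : ∃ n, ∃ l', n :: l' ∈ S := by
      obtain ⟨l, hl⟩ := hne
      obtain ⟨n, l', rfl⟩ := hcons l hl
      exact ⟨n, l', hl⟩
    obtain ⟨l₀, hl₀⟩ := Nat.find_spec hex
    obtain ⟨a, ha, hmin⟩ := ih (Nat.find hex) {l' | Nat.find hex :: l' ∈ S}
      (fun l hl => by simpa [sub] using hS _ hl) ⟨l₀, hl₀⟩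
    refine ⟨Nat.find hex :: a, ha, fun b hb hlt => ?_⟩
    obtain ⟨k, b', rfl⟩ := hcons b hb
    rcases List.cons_lt_cons_iff.1 hlt with h | ⟨h, h'⟩
    · exact Nat.find_min hex h ⟨b', hb⟩
    · subst h
      exact hmin b' hb h'

instance (V : SeqTree X) : IsWellOrder V.MaxNode (lexLT V) where
  trichotomous := by
    rintro ⟨⟨l, x⟩, hl⟩ ⟨⟨m, y⟩, hm⟩ h₁ h₂
    have h : l = m := le_antisymm (not_lt.1 h₂) (not_lt.1 h₁)
    subst h
    have hxy : x = y := by simpa using hl.symm.trans hm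
    subst hxy
    rfl
  wf := by
    rw [WellFounded.wellFounded_iff_has_min]
    rintro S ⟨p, hp⟩
    obtain ⟨a, ⟨q, hq, rfl⟩, hmin⟩ := exists_lex_min V ((fun q : V.MaxNode => q.1.1) '' S)
      (by rintro _ ⟨q, _, rfl⟩; exact ⟨q.1.2, q.2⟩) ⟨_, p, hp, rfl⟩
    exact ⟨q, hq, fun r hr => hmin _ ⟨r, hr, rfl⟩⟩

/-- The order type of a set `U` of maximal elements in the lexicographic order, i.e. the order type
of its image under any function from `max V` to the ordinals that respects the lexicographic
order. -/
noncomputable def ordType (V : SeqTree X) (U : Set X) : Ordinal.{0} :=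
  Ordinal.type (Subrel (lexLT V) fun p : V.MaxNode => p.label ∈ U)

end SeqTree

/-- The biggest (additively) indecomposable ordinal less than or equal to `α`; here `0` counts as
indecomposable, so that `indec 0 = 0`. -/
noncomputable def indec (α : Ordinal.{0}) : Ordinal.{0} :=
  sSup {β | Ordinal.IsPrincipal (· + ·) β ∧ β ≤ α}

namespace SeqTree

variable {X : Type}

/-- `W ⇛ V`: the cascade `W` increases the order of `V`. -/
def IncreasesOrder (W V : SeqTree X) : Prop :=
  W.maxSet ⊆ V.maxSet ∧ ∀ U ⊆ W.maxSet, indec (V.ordType U) ≤ W.ordType U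

/-- The set of elements of rank `α`. -/
def level (V : SeqTree X) (α : Ordinal.{0}) : Set V.Node := {v | rank (up v) = α}

/-- Rank `α` in `V` agrees with rank `β` in `W` with respect to `u`. -/
def RanksAgree (u : Ultrafilter X) (V : SeqTree X) (α : Ordinal.{0}) (W : SeqTree X)
    (β : Ordinal.{0}) : Prop :=
  ∀ A B : V.Node → W.Node → Set X,
    (∀ p ∈ V.level α, ∀ s ∈ W.level β,
      A p s ∈ contour (up p) ∧ B p s ∈ contour (up s)) →
    (⋃ p ∈ V.level α, ⋃ s ∈ W.level β, A p s ∩ B p s) ∈ u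

end SeqTree

/-!
A maximal element of a cascade of finite rank is reached by a finite sequence of natural numbers,
its position. A set belongs to the contour iff for some function `f` on finite sequences it contains
all maximal elements whose position `l` satisfies `f (l.take i) ≤ l[i]` for all `i`
(`mem_contour_iff`). By monotonicity, for a cascade of rank `n` almost all positions have length
`n`. So an ultrafilter `u` that contains the contour sees the cascade as a list of `n` functions,
the entries of the positions, and the description of the contour says that each of them belongs to
a higher sky of `u` than the ones before: it exceeds, on a set of `u`, every given function of them
(`IsMonotoneSequentialCascade.exists_skyChain`).

Skies are linearly ordered. Hence the list for `V` and the list for `W` can be merged into one list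
of functions with increasing skies, in which an entry for `V` and an entry for `W` in the same sky
are combined to one entry, their pair (`SkyChain.exists_merge`). The length of the merged list lies
between the maximum and the sum of the two ranks. The values of the merged list are coordinates for
the points of a set in `u`, and they satisfy the growth condition that makes them, after pruning, the
positions in a cascade `T` with contour in `u` (`exists_uniform_of_coordinates`). Each coordinate in
`V` is a function of a coordinate in `T`, which in turn is bounded in terms of it; this gives the
inclusion of the contours.

For `T ⇛ V`, the relation `ω ^ q ≤ ordType U` has a combinatorial form `Big` which is a recursion over
the entries of the positions (`le_ordType_of_big`, `ordType_lt_of_not_big`). As the coordinates in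
`T` of a point can be taken non-decreasing, an entry of the position in `V` leaves only finitely many
possibilities for the initial part of the position in `T` up to the entry that represents it. By
indecomposability of `ω ^ q` one of these possibilities retains a big part of `U`, and infinitely many
big parts with different initial positions form a set that is big for `q + 1` (`Big.transfer`).
-/

namespace SeqTree

variable {X : Type}

/-! ### The contour in terms of positions -/

/-- The sequence `l` lies above `f`: each of its entries is at least the value of `f` at the
part of `l` that precedes the entry. -/
def Above (f : List ℕ → ℕ) (l : List ℕ) : Prop :=
  ∀ (i : ℕ) (h : i < l.length), f (l.take i) ≤ l[i]

theorem above_nil (f : List ℕ → ℕ) : Above f [] := fun i h => by simp at h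

theorem above_cons {f : List ℕ → ℕ} {a : ℕ} {l : List ℕ} :
    Above f (a :: l) ↔ f [] ≤ a ∧ Above (fun s => f (a :: s)) l := by
  constructor
  · intro h
    exact ⟨h 0 (by simp), fun i hi => h (i + 1) (by simpa using hi)⟩
  · rintro ⟨h0, h⟩ i hi
    cases i with
    | zero => simpa using h0
    | succ i => simpa using h i (by simpa using hi)

theorem above_concat {f : List ℕ → ℕ} {a : ℕ} {l : List ℕ} :
    Above f (l ++ [a]) ↔ Above f l ∧ f l ≤ a := by
  induction l generalizing f with
  | nil => simp [above_cons, above_nil]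
  | cons b l ih => simp [above_cons, ih, and_assoc]

theorem sub_append (V : SeqTree X) (l m : List ℕ) :
    V.sub (l ++ m) = (V.sub l).bind fun t => t.sub m := by
  induction l generalizing V with
  | nil => cases V <;> rfl
  | cons a l ih =>
    cases V with
    | leaf x => rfl
    | node c => simpa [sub] using ih (c a)

@[simp]
theorem sub_nil (V : SeqTree X) : V.sub [] = some V := by cases V <;> rfl

@[simp]
theorem sub_leaf_cons (x : X) (a : ℕ) (l : List ℕ) :
    (leaf x).sub (a :: l) = none := rfl

/-- The sets of positions above `f` are a base of the neighbourhoods of the root. -/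
theorem mem_contour_iff {V : SeqTree X} {U : Set X} :
    U ∈ V.contour ↔ ∃ f : List ℕ → ℕ, ∀ l x, V.sub l = some (leaf x) → Above f l → x ∈ U := by
  constructor
  · intro h
    obtain ⟨O', hO', hU⟩ := mem_comap.1 (mem_map.1 h)
    obtain ⟨O, hOO', hO, hroot⟩ := mem_nhds_iff.1 hO'
    have hex : ∀ l : List ℕ, ∃ b : ℕ, ∀ (hl : (V.sub l).isSome), (⟨l, hl⟩ : V.Node) ∈ O →
        ∀ a, b ≤ a → ∀ h' : (V.sub (l ++ [a])).isSome, (⟨l ++ [a], h'⟩ : V.Node) ∈ O := by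
      intro l
      by_cases hl : ∃ hl : (V.sub l).isSome, (⟨l, hl⟩ : V.Node) ∈ O
      · obtain ⟨hl, hlO⟩ := hl
        have hfin :
            {a | ∃ h' : (V.sub (l ++ [a])).isSome, (⟨l ++ [a], h'⟩ : V.Node) ∉ O}.Finite := by
          refine Set.Finite.of_finite_image (f := fun a => l ++ [a])
            (((hO _ hlO).image Subtype.val).subset ?_) ?_
          · rintro _ ⟨a, ⟨h', ha⟩, rfl⟩
            exact ⟨⟨l ++ [a], h'⟩, ⟨⟨a, rfl⟩, ha⟩, rfl⟩
          · intro a _ b _ hab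
            simpa using hab
        obtain ⟨b, hb⟩ := hfin.bddAbove
        refine ⟨b + 1, fun _ _ a ha h' => ?_⟩
        by_contra hcon
        have := hb (show a ∈ _ from ⟨h', hcon⟩)
        omega
      · exact ⟨0, fun h1 h2 => absurd ⟨h1, h2⟩ hl⟩
    choose f hf using hex
    have key : ∀ (l : List ℕ) (hl : (V.sub l).isSome), Above f l → (⟨l, hl⟩ : V.Node) ∈ O := by
      intro l
      induction l using List.reverseRecOn with
      | nil => intro _ _; exact hroot
      | append_singleton l a ih =>
        intro hl ha
        rw [above_concat] at ha
        have hl' : (V.sub l).isSome := by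
          rw [sub_append] at hl
          cases h : V.sub l with
          | none => simp [h] at hl
          | some t => rfl
        exact hf l hl' (ih hl' ha.1) a ha.2 hl
    refine ⟨f, fun l x hl hf => ?_⟩
    have : (⟨(l, x), hl⟩ : V.MaxNode) ∈ MaxNode.label (V := V) ⁻¹' U :=
      hU (hOO' (key l (by rw [hl]; rfl) hf))
    exact this
  · rintro ⟨f, hf⟩
    refine mem_map.2 (mem_comap.2 ⟨{v | Above f v.1}, ?_, ?_⟩)
    · refine IsOpen.mem_nhds ?_ (above_nil f)
      intro v hv
      refine ((Set.finite_lt_nat (f v.1)).image fun a => v.1 ++ [a]).preimage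
        (f := Subtype.val) Subtype.val_injective.injOn |>.subset ?_
      rintro w ⟨⟨a, ha⟩, hw⟩
      refine ⟨a, ?_, ha.symm⟩
      by_contra hcon
      refine hw ?_
      change Above f w.1
      rw [ha, above_concat]
      exact ⟨hv, not_lt.1 hcon⟩
    · intro p hp
      exact hf _ _ p.2 hp

theorem mem_contour_leaf {x : X} {U : Set X} : U ∈ (leaf x).contour ↔ x ∈ U := by
  rw [mem_contour_iff]
  constructor
  · rintro ⟨f, hf⟩
    exact hf [] x rfl (above_nil f)
  · intro hx
    refine ⟨fun _ => 0, fun l y hl _ => ?_⟩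
    cases l with
    | nil => simp at hl; exact hl ▸ hx
    | cons a l => simp at hl

theorem mem_contour_node {c : ℕ → SeqTree X} {U : Set X} :
    U ∈ (node c).contour ↔ ∃ b, ∀ a, b ≤ a → U ∈ (c a).contour := by
  simp only [mem_contour_iff]
  constructor
  · rintro ⟨f, hf⟩
    exact ⟨f [], fun a ha => ⟨fun s => f (a :: s), fun l x hl h =>
      hf (a :: l) x hl (above_cons.2 ⟨ha, h⟩)⟩⟩
  · rintro ⟨b, hb⟩
    have : ∀ a, ∃ f : List ℕ → ℕ, b ≤ a →
        ∀ l x, (c a).sub l = some (leaf x) → Above f l → x ∈ U := by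
      intro a
      by_cases h : b ≤ a
      · obtain ⟨f, hf⟩ := hb a h
        exact ⟨f, fun _ => hf⟩
      · exact ⟨fun _ => 0, fun h' => absurd h' h⟩
    choose f hf using this
    refine ⟨fun s => match s with
      | [] => b
      | a :: s => f a s, fun l x hl h => ?_⟩
    cases l with
    | nil => simp at hl
    | cons a l =>
      rw [above_cons] at h
      exact hf a h.1 l x hl h.2

/-! ### Ranks and monotone cascades -/

theorem IsMonotoneSequentialCascade.eq_of_sub {V : SeqTree X} (hV : V.IsMonotoneSequentialCascade)
    {l m : List ℕ} {x : X} (hl : V.sub l = some (leaf x)) (hm : V.sub m = some (leaf x)) :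
    l = m := by
  have h := @hV.label_injective ⟨(l, x), hl⟩ ⟨(m, x), hm⟩ rfl
  simpa using congrArg (fun p : V.MaxNode => p.1.1) h

theorem up_eq_iff {V : SeqTree X} (v : V.Node) (t : SeqTree X) :
    up v = t ↔ V.sub v.1 = some t := by
  exact ⟨fun h => h ▸ (Option.some_get v.2).symm, fun h => by simp [up, h]⟩

theorem IsMonotoneSequentialCascade.child {c : ℕ → SeqTree X}
    (h : (node c).IsMonotoneSequentialCascade) (a : ℕ) : (c a).IsMonotoneSequentialCascade where
  label_injective := by
    rintro ⟨⟨l, x⟩, hl⟩ ⟨⟨m, y⟩, hm⟩ (rfl : x = y)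
    have := h.eq_of_sub (l := a :: l) (m := a :: m) hl hm
    simp only [List.cons.injEq, true_and] at this
    subst this
    rfl
  monotone_rank := by
    intro v d hd
    rw [up_eq_iff] at hd
    exact h.monotone_rank ⟨a :: v.1, v.2⟩ d ((up_eq_iff _ _).2 hd)

theorem rank_child_lt (c : ℕ → SeqTree X) (a : ℕ) : (c a).rank < (node c).rank :=
  Order.succ_le_iff.1 (Ordinal.le_iSup (fun n => Order.succ (rank (c n))) a)

/-- In a monotone cascade of finite rank `n`, all but finitely many successors of a node of rank
`k + 1` have rank `k`; so in the sense of the contour almost all maximal elements have height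
`n`. -/
theorem IsMonotoneSequentialCascade.exists_above_length {V : SeqTree X}
    (hV : V.IsMonotoneSequentialCascade) {n : ℕ} (hn : V.rank = n) :
    ∃ f : List ℕ → ℕ, ∀ l x, V.sub l = some (leaf x) → Above f l → l.length = n := by
  induction V generalizing n with
  | leaf x =>
    refine ⟨fun _ => 0, fun l y hl _ => ?_⟩
    have h0 : n = 0 := by
      have : (0 : Ordinal) = n := hn
      exact_mod_cast this.symm
    cases l with
    | nil => simp [h0]
    | cons a l => simp at hl
  | node c ih =>
    obtain ⟨k, rfl⟩ : ∃ k, n = k + 1 := by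
      refine Nat.exists_eq_succ_of_ne_zero ?_
      rintro rfl
      have := rank_child_lt c 0
      simp [hn] at this
    have hle : ∀ a, (c a).rank ≤ k := by
      intro a
      have := rank_child_lt c a
      rw [hn, Nat.cast_succ] at this
      exact Order.lt_succ_iff.1 this
    obtain ⟨b, hb⟩ : ∃ b, (k : Ordinal) ≤ (c b).rank := by
      by_contra! hcon
      have : (node c).rank ≤ k := Ordinal.iSup_le fun a => Order.succ_le_iff.2 (hcon a)
      rw [hn] at this
      have := Nat.cast_le.1 this
      omega
    have hmono := hV.monotone_rank (root (node c)) c ((up_eq_iff _ _).2 rfl)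
    have : ∀ a, ∃ f : List ℕ → ℕ, b ≤ a →
        ∀ l x, (c a).sub l = some (leaf x) → Above f l → l.length = k := by
      intro a
      by_cases h : b ≤ a
      · obtain ⟨f, hf⟩ := ih a (hV.child a) (le_antisymm (hle a) (hb.trans (hmono h)))
        exact ⟨f, fun _ => hf⟩
      · exact ⟨fun _ => 0, fun h' => absurd h' h⟩
    choose f hf using this
    refine ⟨fun s => match s with
      | [] => b
      | a :: s => f a s, fun l x hl h => ?_⟩
    cases l with
    | nil => simp at hl
    | cons a l =>
      rw [above_cons] at h
      simpa using hf a h.1 l x hl h.2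

/-- All maximal elements have height `k`. -/
inductive Uniform : ℕ → SeqTree X → Prop
  | leaf (x : X) : Uniform 0 (leaf x)
  | node {k : ℕ} {c : ℕ → SeqTree X} (h : ∀ a, Uniform k (c a)) : Uniform (k + 1) (node c)

theorem Uniform.rank_eq {k : ℕ} {V : SeqTree X} (h : Uniform k V) : V.rank = k := by
  induction h with
  | leaf x => simp [rank]
  | @node k c h ih =>
    have : (SeqTree.node c).rank = ⨆ _ : ℕ, Order.succ (k : Ordinal) := by
      simp only [rank, ih]
    rw [this, ciSup_const, Nat.cast_succ]
    rfl

theorem Uniform.exists_sub {k : ℕ} {V W : SeqTree X} (h : Uniform k V) {l : List ℕ}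
    (hl : V.sub l = some W) : ∃ j, Uniform j W := by
  induction h generalizing l with
  | leaf x =>
    cases l with
    | nil => simp at hl; exact ⟨0, hl ▸ .leaf x⟩
    | cons a l => simp at hl
  | @node k c h ih =>
    cases l with
    | nil => simp at hl; exact ⟨k + 1, hl ▸ .node h⟩
    | cons a l => exact ih a hl

theorem Uniform.isMonotoneSequentialCascade {k : ℕ} {V : SeqTree X} (h : Uniform k V)
    (hinj : ∀ l m x, V.sub l = some (SeqTree.leaf x) → V.sub m = some (SeqTree.leaf x) → l = m) :
    V.IsMonotoneSequentialCascade where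
  label_injective := by
    rintro ⟨⟨l, x⟩, hl⟩ ⟨⟨m, y⟩, hm⟩ (rfl : x = y)
    obtain rfl := hinj l m x hl hm
    rfl
  monotone_rank := by
    intro v c hc
    obtain ⟨j, hj⟩ := h.exists_sub ((up_eq_iff _ _).1 hc)
    cases hj with
    | node hj =>
      intro a b _
      simp only [(hj _).rank_eq, le_refl]

/-! ### Order types at least `ω ^ q` -/

/-- The sequences `l` for which `a :: l` belongs to `S`. -/
def tails (a : ℕ) (S : Set (List ℕ)) : Set (List ℕ) := {l | a :: l ∈ S}

/-- A combinatorial form of "the lexicographic order type of `S` is at least `ω ^ q`": it holds for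
`q = 0` if `S` is nonempty, it is inherited from the tails of `S` at one entry, and it holds for
`q + 1` if the tails of `S` at infinitely many entries are big for `q`. -/
inductive Big : ℕ → Set (List ℕ) → Prop
  | zero {S : Set (List ℕ)} (h : S.Nonempty) : Big 0 S
  | tails {q : ℕ} {S : Set (List ℕ)} (a : ℕ) (h : Big q (tails a S)) : Big q S
  | succ {q : ℕ} {S : Set (List ℕ)} {A : Set ℕ} (hA : A.Infinite)
      (h : ∀ a ∈ A, Big q (SeqTree.tails a S)) : Big (q + 1) S

theorem Big.mono {q : ℕ} {S T : Set (List ℕ)} (h : Big q S) (hST : S ⊆ T) : Big q T := by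
  induction h generalizing T with
  | zero h => exact .zero (h.mono hST)
  | tails a h ih => exact .tails a (ih fun l hl => hST hl)
  | succ hA h ih => exact .succ hA fun a ha => ih a ha fun l hl => hST hl

theorem Big.exists_le_length {q : ℕ} {S : Set (List ℕ)} (h : Big q S) :
    ∃ l ∈ S, q ≤ l.length := by
  induction h with
  | zero h =>
    obtain ⟨l, hl⟩ := h
    exact ⟨l, hl, Nat.zero_le _⟩
  | tails a h ih =>
    obtain ⟨l, hl, hq⟩ := ih
    exact ⟨a :: l, hl, by simp; omega⟩
  | succ hA h ih =>
    obtain ⟨a, ha⟩ := hA.nonempty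
    obtain ⟨l, hl, hq⟩ := ih a ha
    exact ⟨a :: l, hl, by simpa using hq⟩

theorem Big.nonempty {q : ℕ} {S : Set (List ℕ)} (h : Big q S) : S.Nonempty :=
  let ⟨l, hl, _⟩ := h.exists_le_length
  ⟨l, hl⟩

theorem Big.of_union {q : ℕ} {R S T : Set (List ℕ)} (h : Big q R) (hR : R ⊆ S ∪ T) :
    Big q S ∨ Big q T := by
  induction h generalizing S T with
  | zero h =>
    obtain ⟨l, hl⟩ := h
    exact (hR hl).imp (fun h => .zero ⟨l, h⟩) fun h => .zero ⟨l, h⟩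
  | tails a h ih =>
    exact (ih (S := SeqTree.tails a S) (T := SeqTree.tails a T) fun l hl => hR hl).imp
      (.tails a) (.tails a)
  | @succ q R A hA h ih =>
    have hcover : A ⊆ {a ∈ A | Big q (SeqTree.tails a S)} ∪ {a ∈ A | Big q (SeqTree.tails a T)} :=
      fun a ha => (ih a ha (S := SeqTree.tails a S) (T := SeqTree.tails a T)
        fun l hl => hR hl).imp (fun h => ⟨ha, h⟩) fun h => ⟨ha, h⟩
    rcases Set.infinite_union.1 (hA.mono hcover) with h | h
    · exact .inl (.succ h fun a ha => ha.2)
    · exact .inr (.succ h fun a ha => ha.2)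

/-- Bigness is preserved by some piece of a finite partition, because `ω ^ q` is additively
indecomposable. -/
theorem Big.exists_fiber {ι : Type*} {q : ℕ} {S : Set (List ℕ)} (h : Big q S) {g : List ℕ → ι}
    {F : Set ι} (hF : F.Finite) (hg : ∀ s ∈ S, g s ∈ F) : ∃ i, Big q {s ∈ S | g s = i} := by
  induction F, hF using Set.Finite.induction_on generalizing S with
  | empty =>
    obtain ⟨l, hl⟩ := h.nonempty
    exact absurd (hg l hl) (Set.notMem_empty _)
  | @insert i F _ _ ih =>
    have : S ⊆ {s ∈ S | g s = i} ∪ {s ∈ S | g s ∈ F} := fun s hs =>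
      (hg s hs).imp (fun h => ⟨hs, h⟩) fun h => ⟨hs, h⟩
    rcases h.of_union this with h | h
    · exact ⟨i, h⟩
    · obtain ⟨j, hj⟩ := ih h fun s hs => hs.2
      exact ⟨j, hj.mono fun s hs => ⟨hs.1.1, hs.2⟩⟩

/-- If all members of `S` start with `a`, then bigness of `S` is bigness of its tails at `a`. -/
theorem Big.tails_of_forall {q : ℕ} {S : Set (List ℕ)} (h : Big q S) {a : ℕ}
    (hS : ∀ s ∈ S, ∃ l, s = a :: l) : Big q (SeqTree.tails a S) := by
  have key : ∀ {b p}, Big p (SeqTree.tails b S) → b = a := by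
    intro b p hb
    obtain ⟨l, hl⟩ := hb.nonempty
    obtain ⟨m, hm⟩ := hS _ hl
    simp at hm
    exact hm.1
  cases h with
  | zero h =>
    obtain ⟨s, hs⟩ := h
    obtain ⟨l, rfl⟩ := hS s hs
    exact .zero ⟨l, hs⟩
  | tails b h => exact key h ▸ h
  | succ hA h =>
    refine absurd (hA.mono fun b hb => ?_) (Set.finite_singleton a).not_infinite
    exact key (h b hb)

/-- Infinitely many big pieces, separated by their initial parts of a fixed length, make a set
that is big for the next exponent. -/
theorem Big.of_infinite_take {q i : ℕ} {S : Set (List ℕ)} {A : Set (List ℕ)} (hA : A.Infinite)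
    (h : ∀ t ∈ A, Big q {s ∈ S | s.take i = t}) : Big (q + 1) S := by
  induction i generalizing S A with
  | zero =>
    refine absurd (hA.mono fun t ht => ?_) (Set.finite_singleton ([] : List ℕ)).not_infinite
    obtain ⟨s, hs⟩ := (h t ht).nonempty
    simpa using hs.2.symm
  | succ i ih =>
    have hB : (A \ {[]}).Infinite := hA.sdiff (Set.finite_singleton _)
    have hbig : ∀ a t, a :: t ∈ A → Big q {s ∈ SeqTree.tails a S | s.take i = t} := by
      intro a t ht
      refine ((h _ ht).tails_of_forall (a := a) ?_).mono ?_
      · rintro s ⟨_, hs⟩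
        cases s with
        | nil => simp at hs
        | cons b s =>
          simp at hs
          exact ⟨s, by rw [hs.1]⟩
      · rintro s ⟨hs, hst⟩
        exact ⟨hs, by simpa using hst⟩
    by_cases hfin : {a | (SeqTree.tails a A).Nonempty}.Finite
    · obtain ⟨a, ha⟩ : ∃ a, (SeqTree.tails a A).Infinite := by
        by_contra! hcon
        refine hB ((hfin.biUnion fun a _ => (hcon a).image (List.cons a)).subset ?_)
        rintro t ⟨htA, htn⟩
        cases t with
        | nil => exact absurd rfl htn
        | cons a t => exact Set.mem_biUnion (x := a) ⟨t, htA⟩ ⟨t, htA, rfl⟩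
      exact .tails a (ih ha fun t ht => hbig a t ht)
    · refine .succ hfin fun a ha => ?_
      obtain ⟨t, ht⟩ := ha
      exact (hbig a t ht).mono fun s hs => hs.1

/-- A big set contains a copy of `ω ^ q` in the lexicographic order. -/
theorem Big.exists_strictMono {q : ℕ} {S : Set (List ℕ)} (h : Big q S) :
    ∃ g : Ordinal.{0} → List ℕ, ∀ a < Ordinal.omega0 ^ (q : Ordinal.{0}),
      g a ∈ S ∧ ∀ b < a, g b < g a := by
  induction h with
  | zero h =>
    obtain ⟨s, hs⟩ := h
    refine ⟨fun _ => s, fun a ha => ⟨hs, fun b hb => ?_⟩⟩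
    simp at ha
    subst ha
    simp at hb
  | tails a h ih =>
    obtain ⟨g, hg⟩ := ih
    exact ⟨fun o => a :: g o, fun o ho => ⟨(hg o ho).1, fun b hb =>
      List.cons_lt_cons_iff.2 (.inr ⟨rfl, (hg o ho).2 b hb⟩)⟩⟩
  | @succ q S A hA h ih =>
    have hlt : ∀ j, Nat.nth (· ∈ A) j ∈ A := fun j => Nat.nth_mem_of_infinite hA j
    choose g hg using fun j => ih _ (hlt j)
    -- Write `o < ω ^ (q + 1)` as `ω ^ q * j + r` with `r < ω ^ q`: the quotient `j` selects the `j`th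
    -- entry in `A`, and the remainder `r` is embedded into the tails at that entry.
    have hpos : (Ordinal.omega0 ^ (q : Ordinal.{0})) ≠ 0 :=
      (Ordinal.opow_pos _ Ordinal.omega0_pos).ne'
    have hdiv : ∀ o < Ordinal.omega0 ^ ((q + 1 : ℕ) : Ordinal.{0}),
        ∃ j : ℕ, o / Ordinal.omega0 ^ (q : Ordinal.{0}) = j := by
      intro o ho
      refine Ordinal.lt_omega0.1 ((Ordinal.lt_mul_iff_div_lt hpos).1 ?_)
      rwa [Nat.cast_succ, ← Order.succ_eq_add_one, Ordinal.opow_succ] at ho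
    classical
    let J : Ordinal.{0} → ℕ := fun o =>
      if h : ∃ j : ℕ, o / Ordinal.omega0 ^ (q : Ordinal.{0}) = j then h.choose else 0
    have hJ : ∀ o < Ordinal.omega0 ^ ((q + 1 : ℕ) : Ordinal.{0}),
        o / Ordinal.omega0 ^ (q : Ordinal.{0}) = J o := by
      intro o ho
      have := hdiv o ho
      simp only [J, dif_pos this]
      exact this.choose_spec
    refine ⟨fun o => Nat.nth (· ∈ A) (J o) :: g (J o) (o % Ordinal.omega0 ^ (q : Ordinal.{0})),
      fun o ho => ⟨(hg _ _ (Ordinal.mod_lt _ hpos)).1, fun b hb => List.cons_lt_cons_iff.2 ?_⟩⟩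
    have hle : J b ≤ J o := by
      have : (J b : Ordinal.{0}) ≤ J o := by
        rw [← hJ o ho, ← hJ b (hb.trans ho)]
        exact Ordinal.div_le_left hb.le _
      exact_mod_cast this
    rcases hle.lt_or_eq with hlt | heq
    · exact .inl ((Nat.nth_lt_nth hA).2 hlt)
    · refine .inr ⟨by rw [heq], ?_⟩
      rw [heq]
      refine (hg _ _ (Ordinal.mod_lt _ hpos)).2 _ ?_
      have h1 := Ordinal.div_add_mod o (Ordinal.omega0 ^ (q : Ordinal.{0}))
      have h2 := Ordinal.div_add_mod b (Ordinal.omega0 ^ (q : Ordinal.{0}))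
      rw [hJ o ho] at h1
      rw [hJ b (hb.trans ho), heq] at h2
      rw [← h1, ← h2] at hb
      simpa using hb

/-- The positions of the maximal elements that belong to `U`. -/
def positions (V : SeqTree X) (U : Set X) : Set (List ℕ) :=
  {l | ∃ x ∈ U, V.sub l = some (leaf x)}

theorem positions_leaf_subset (x : X) (U : Set X) : (leaf x).positions U ⊆ {[]} := by
  rintro l ⟨y, -, hl⟩
  cases l with
  | nil => rfl
  | cons a l => simp at hl

/-- If the positions of `U` are not big for `q`, they embed into an ordinal below `ω ^ q`: at each
node all successors contribute less than `ω ^ (q + 1)`, and almost all contribute less than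
`ω ^ q`, so that their ordered sum stays below `ω ^ (q + 1)`. -/
theorem exists_strictMono_of_not_big (V : SeqTree X) (U : Set X) (q : ℕ)
    (h : ¬ Big q (V.positions U)) :
    ∃ β < Ordinal.omega0 ^ (q : Ordinal.{0}), ∃ f : List ℕ → Ordinal.{0},
      ∀ l ∈ V.positions U, f l < β ∧ ∀ m ∈ V.positions U, m < l → f m < f l := by
  induction V generalizing q with
  | leaf x =>
    cases q with
    | zero =>
      exact ⟨0, by simp, fun _ => 0, fun l hl => absurd (.zero ⟨l, hl⟩) h⟩
    | succ q =>
      refine ⟨1, ?_, fun _ => 0, fun l hl => ⟨zero_lt_one, fun m hm hml => ?_⟩⟩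
      · rw [← Ordinal.opow_zero Ordinal.omega0]
        exact (Ordinal.opow_lt_opow_iff_right Ordinal.one_lt_omega0).2
          (by exact_mod_cast q.succ_pos)
      · have h1 : l = [] := positions_leaf_subset x U hl
        have h2 : m = [] := positions_leaf_subset x U hm
        simp [h1, h2] at hml
  | node c ih =>
    cases q with
    | zero =>
      exact ⟨0, by simp, fun _ => 0, fun l hl => absurd (.zero ⟨l, hl⟩) h⟩
    | succ q =>
      have hlt :
          Ordinal.omega0 ^ (q : Ordinal.{0}) < Ordinal.omega0 ^ ((q + 1 : ℕ) : Ordinal.{0}) :=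
        (Ordinal.opow_lt_opow_iff_right Ordinal.one_lt_omega0).2 (by exact_mod_cast q.lt_succ_self)
      have hex : ∀ a, ∃ β < Ordinal.omega0 ^ ((q + 1 : ℕ) : Ordinal.{0}),
          ∃ f : List ℕ → Ordinal.{0},
          (¬ Big q ((c a).positions U) → β < Ordinal.omega0 ^ (q : Ordinal.{0})) ∧
          ∀ l ∈ (c a).positions U, f l < β ∧ ∀ m ∈ (c a).positions U, m < l → f m < f l := by
        intro a
        by_cases hq : Big q ((c a).positions U)
        · obtain ⟨β, hβ, f, hf⟩ := ih a (q + 1) fun h' => h (.tails a h')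
          exact ⟨β, hβ, f, fun h' => absurd hq h', hf⟩
        · obtain ⟨β, hβ, f, hf⟩ := ih a q hq
          exact ⟨β, hβ.trans hlt, f, fun _ => hβ, hf⟩
      choose β hβ f hβq hf using hex
      obtain ⟨N, hN⟩ : ∃ N, ∀ a, N ≤ a → β a < Ordinal.omega0 ^ (q : Ordinal.{0}) := by
        have hfin : {a | Big q ((c a).positions U)}.Finite := by
          by_contra hinf
          exact h (.succ hinf fun a ha => ha)
        obtain ⟨b, hb⟩ := hfin.bddAbove
        refine ⟨b + 1, fun a ha => hβq a fun h' => ?_⟩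
        have := hb h'
        omega
      -- `s k` is the space used by the first `k` successors.
      let s : ℕ → Ordinal.{0} := fun k => Nat.rec 0 (fun i o => o + β i) k
      have hs : ∀ k, s (k + 1) = s k + β k := fun k => rfl
      have hmono : Monotone s := monotone_nat_of_le_succ fun k => by
        rw [hs]
        exact le_self_add
      have hslt : ∀ k, s k < Ordinal.omega0 ^ ((q + 1 : ℕ) : Ordinal.{0}) := by
        intro k
        induction k with
        | zero => exact Ordinal.opow_pos _ Ordinal.omega0_pos
        | succ k ihk =>
          rw [hs]
          exact Ordinal.isPrincipal_add_omega0_opow _ ihk (hβ k)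
      have hsN : ∀ j, ∃ γ < Ordinal.omega0 ^ (q : Ordinal.{0}), s (N + j) = s N + γ := by
        intro j
        induction j with
        | zero => exact ⟨0, Ordinal.opow_pos _ Ordinal.omega0_pos, by simp⟩
        | succ j ihj =>
          obtain ⟨γ, hγ, hj⟩ := ihj
          refine ⟨γ + β (N + j), Ordinal.isPrincipal_add_omega0_opow _ hγ (hN _ (by omega)), ?_⟩
          rw [← add_assoc, hs, hj, add_assoc]
      refine ⟨s N + Ordinal.omega0 ^ (q : Ordinal.{0}),
        Ordinal.isPrincipal_add_omega0_opow _ (hslt N) hlt,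
        fun l => match l with
          | [] => 0
          | a :: l => s a + f a l, ?_⟩
      intro l hl
      cases l with
      | nil =>
        obtain ⟨x, _, hx⟩ := hl
        simp at hx
      | cons a l =>
        have hal : f a l < β a := (hf a l hl).1
        constructor
        · have h1 : s a + f a l < s (a + 1) := by
            rw [hs]
            exact add_lt_add_right hal _
          obtain ⟨γ, hγ, hj⟩ := hsN (a + 1)
          calc s a + f a l < s (a + 1) := h1
            _ ≤ s (N + (a + 1)) := hmono (show a + 1 ≤ N + (a + 1) by omega)
            _ = s N + γ := hj
            _ ≤ _ := add_le_add_right hγ.le _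
        · intro m hm hml
          cases m with
          | nil =>
            obtain ⟨x, _, hx⟩ := hm
            simp at hx
          | cons b m =>
            rcases List.cons_lt_cons_iff.1 hml with hba | ⟨rfl, hml'⟩
            · calc s b + f b m < s b + β b := add_lt_add_right (hf b m hm).1 _
                _ = s (b + 1) := (hs b).symm
                _ ≤ s a := hmono hba
                _ ≤ s a + f a l := le_self_add
            · exact add_lt_add_right ((hf b l hl).2 m hm hml') _

theorem le_ordType_of_big {V : SeqTree X} {U : Set X} {q : ℕ} (h : Big q (V.positions U)) :
    Ordinal.omega0 ^ (q : Ordinal.{0}) ≤ V.ordType U := by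
  obtain ⟨g, hg⟩ := h.exists_strictMono
  by_contra! hlt
  have : ∀ o < Ordinal.omega0 ^ (q : Ordinal.{0}), ∀ p : {p : V.MaxNode // p.label ∈ U},
      p.1.1.1 = g o → o ≤ Ordinal.typein (Subrel (lexLT V) fun p : V.MaxNode => p.label ∈ U) p := by
    intro o
    induction o using WellFoundedLT.induction with
    | _ o ih =>
      intro ho p hp
      refine le_of_forall_lt fun b hb => ?_
      obtain ⟨x, hx, hl⟩ := (hg b (hb.trans ho)).1
      refine (ih b hb (hb.trans ho) ⟨⟨(g b, x), hl⟩, hx⟩ rfl).trans_lt ?_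
      rw [Ordinal.typein_lt_typein]
      change g b < p.1.1.1
      rw [hp]
      exact (hg o ho).2 b hb
  obtain ⟨x, hx, hl⟩ := (hg _ hlt).1
  exact (this _ hlt ⟨⟨(_, x), hl⟩, hx⟩ rfl).not_gt (Ordinal.typein_lt_type _ _)

theorem ordType_lt_of_not_big {V : SeqTree X} {U : Set X} {q : ℕ}
    (h : ¬ Big q (V.positions U)) : V.ordType U < Ordinal.omega0 ^ (q : Ordinal.{0}) := by
  obtain ⟨β, hβ, f, hf⟩ := V.exists_strictMono_of_not_big U q h
  refine lt_of_le_of_lt ?_ hβ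
  by_contra! hlt
  have hmem : ∀ p : {p : V.MaxNode // p.label ∈ U}, p.1.1.1 ∈ V.positions U :=
    fun p => ⟨p.1.1.2, p.2, p.1.2⟩
  have : ∀ o, ∀ p : {p : V.MaxNode // p.label ∈ U},
      Ordinal.typein (Subrel (lexLT V) fun p : V.MaxNode => p.label ∈ U) p = o →
      o ≤ f p.1.1.1 := by
    intro o
    induction o using WellFoundedLT.induction with
    | _ o ih =>
      intro p hp
      refine le_of_forall_lt fun b hb => ?_
      obtain ⟨r, hr⟩ := Ordinal.typein_surj (Subrel (lexLT V) fun p : V.MaxNode => p.label ∈ U)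
        (hb.trans (hp ▸ Ordinal.typein_lt_type _ p))
      refine (ih b hb r hr).trans_lt ((hf _ (hmem p)).2 _ (hmem r) ?_)
      have : Ordinal.typein (Subrel (lexLT V) fun p : V.MaxNode => p.label ∈ U) r <
          Ordinal.typein (Subrel (lexLT V) fun p : V.MaxNode => p.label ∈ U) p := by
        rwa [hr, hp]
      exact (Ordinal.typein_lt_typein (Subrel (lexLT V) fun p : V.MaxNode => p.label ∈ U)).1 this
  obtain ⟨p, hp⟩ := Ordinal.typein_surj (Subrel (lexLT V) fun p : V.MaxNode => p.label ∈ U) hlt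
  exact (this β p hp).not_gt (hf _ (hmem p)).1

/-! ### Comparing bigness for two systems of coordinates -/

/-- Bigness passes from the coordinates `ξ` to the coordinates `ζ` if each entry of `ξ` is
determined by some initial part of `ζ`, and this initial part takes only finitely many values once
the entry of `ξ` is fixed. -/
theorem Big.transfer {q : ℕ} {U : Set X} {ξ ζ : X → List ℕ} (h : Big q (ξ '' U))
    (H : ∀ i : ℕ, ∃ l : ℕ, (∀ c, {t | ∃ x ∈ U, (ξ x)[i]? = some c ∧ (ζ x).take l = t}.Finite) ∧
      ∀ x ∈ U, ∀ y ∈ U, (ζ x).take l = (ζ y).take l → (ξ x)[i]? = (ξ y)[i]?) :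
    Big q (ζ '' U) := by
  have htails : ∀ (ξ : X → List ℕ) (U : Set X) (a : ℕ),
      SeqTree.tails a (ξ '' U) = (fun x => (ξ x).tail) '' {x ∈ U | ∃ t, ξ x = a :: t} := by
    intro ξ U a
    ext t
    constructor
    · rintro ⟨x, hx, hxt⟩
      exact ⟨x, ⟨hx, t, hxt⟩, by simp [hxt]⟩
    · rintro ⟨x, ⟨hx, t', hxt⟩, rfl⟩
      exact ⟨x, hx, by simp [hxt]⟩
  have hH : ∀ {ξ : X → List ℕ} {U : Set X}, (∀ i : ℕ, ∃ l : ℕ,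
      (∀ c, {t | ∃ x ∈ U, (ξ x)[i]? = some c ∧ (ζ x).take l = t}.Finite) ∧
      ∀ x ∈ U, ∀ y ∈ U, (ζ x).take l = (ζ y).take l → (ξ x)[i]? = (ξ y)[i]?) →
      ∀ (a i : ℕ), ∃ l : ℕ, (∀ c, {t | ∃ x ∈ {x ∈ U | ∃ t, ξ x = a :: t},
        (ξ x).tail[i]? = some c ∧ (ζ x).take l = t}.Finite) ∧
      ∀ x ∈ {x ∈ U | ∃ t, ξ x = a :: t}, ∀ y ∈ {x ∈ U | ∃ t, ξ x = a :: t},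
        (ζ x).take l = (ζ y).take l → (ξ x).tail[i]? = (ξ y).tail[i]? := by
    intro ξ U H a i
    obtain ⟨l, h1, h2⟩ := H (i + 1)
    simp only [List.getElem?_tail]
    refine ⟨l, fun c => (h1 c).subset ?_, fun x hx y hy => h2 x hx.1 y hy.1⟩
    rintro t ⟨x, hx, ht⟩
    exact ⟨x, hx.1, ht⟩
  generalize hR : ξ '' U = R at h
  induction h generalizing ξ U with
  | zero h =>
    subst hR
    exact .zero (h.of_image.image ζ)
  | tails a h ih =>
    subst hR
    exact (ih (hH H a) (htails ξ U a).symm).mono (Set.image_mono fun x hx => hx.1)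
  | @succ q R A hA h ih =>
    subst hR
    obtain ⟨l, h1, h2⟩ := H 0
    have hex : ∀ a ∈ A, ∃ t, Big q {s ∈ ζ '' {x ∈ U | ∃ t, ξ x = a :: t} | s.take l = t} := by
      intro a ha
      refine (ih a ha (hH H a) (htails ξ U a).symm).exists_fiber (h1 a) ?_
      rintro _ ⟨x, ⟨hx, t, hxt⟩, rfl⟩
      exact ⟨x, hx, by simp [hxt], rfl⟩
    choose! τ hτ using hex
    refine Big.of_infinite_take (i := l) (A := τ '' A) (hA.image ?_) ?_
    · intro a ha b hb hab
      obtain ⟨_, ⟨x, ⟨hx, t, hxt⟩, rfl⟩, hx'⟩ := (hτ a ha).nonempty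
      obtain ⟨_, ⟨y, ⟨hy, t', hyt⟩, rfl⟩, hy'⟩ := (hτ b hb).nonempty
      have := h2 x hx y hy (hx'.trans (hab.trans hy'.symm))
      simpa [hxt, hyt] using this
    · rintro _ ⟨a, ha, rfl⟩
      refine (hτ a ha).mono ?_
      rintro _ ⟨⟨x, hx, rfl⟩, hs⟩
      exact ⟨⟨x, hx.1, rfl⟩, hs⟩

/-! ### A cascade with prescribed coordinates -/

/-- Let `ζ` attach sequences of length `k` to the elements of `D`, injectively, such that above each
`f` there is some `ζ x`. Discarding the initial sequences that have only finitely many essential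
continuations leaves a cascade of rank `k`. It enumerates the remaining successors in increasing
order; its contour is generated by the sets of those `x` with `ζ x` above `f`. -/
theorem exists_uniform_of_coordinates (k : ℕ) (D : Set X) (ζ : X → List ℕ)
    (hlen : ∀ x ∈ D, (ζ x).length = k) (hinj : Set.InjOn ζ D)
    (hpos : ∀ f, ∃ x ∈ D, Above f (ζ x)) :
    ∃ T : SeqTree X, Uniform k T ∧
      (∀ l m x, T.sub l = some (leaf x) → T.sub m = some (leaf x) → l = m) ∧
      (∀ l x, T.sub l = some (leaf x) → x ∈ D) ∧
      (∀ U, U ∈ T.contour ↔ ∃ f, ∀ x ∈ D, Above f (ζ x) → x ∈ U) ∧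
      ∀ q U, Big q (ζ '' {x ∈ U | ∃ l, T.sub l = some (leaf x)}) → Big q (T.positions U) := by
  induction k generalizing D ζ with
  | zero =>
    obtain ⟨x, hx, -⟩ := hpos fun _ => 0
    have hnil : ∀ y ∈ D, ζ y = [] := fun y hy => List.length_eq_zero_iff.1 (hlen y hy)
    have huniq : ∀ y ∈ D, y = x := fun y hy => hinj hy hx ((hnil y hy).trans (hnil x hx).symm)
    have hleaf : ∀ l y, (leaf x).sub l = some (leaf y) → l = [] ∧ y = x := by
      intro l y hl
      cases l with
      | nil => simp at hl; exact ⟨rfl, hl.symm⟩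
      | cons a l => simp at hl
    refine ⟨leaf x, .leaf x, fun l m y hl hm => ?_, fun l y hl => ?_, fun U => ?_, fun q U h => ?_⟩
    · rw [(hleaf l y hl).1, (hleaf m y hm).1]
    · rwa [(hleaf l y hl).2]
    · rw [mem_contour_leaf]
      refine ⟨fun h => ⟨fun _ => 0, fun y hy _ => huniq y hy ▸ h⟩, ?_⟩
      rintro ⟨f, hf⟩
      refine hf x hx ?_
      rw [hnil x hx]
      exact above_nil f
    · refine h.mono ?_
      rintro _ ⟨y, ⟨hy, l, hl⟩, rfl⟩
      have := (hleaf l y hl).2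
      subst this
      exact ⟨y, hy, by rw [hnil y hx]; rfl⟩
  | succ k ih =>
    let D' : ℕ → Set X := fun a => {x ∈ D | ∃ t, ζ x = a :: t}
    let ζ' : X → List ℕ := fun x => (ζ x).tail
    have hζ : ∀ a, ∀ x ∈ D' a, ζ x = a :: ζ' x := by
      rintro a x ⟨_, t, ht⟩
      simp [ζ', ht]
    have hD : ∀ x ∈ D, ∃ a, x ∈ D' a := by
      intro x hx
      have := hlen x hx
      cases h : ζ x with
      | nil => simp [h] at this
      | cons a t => exact ⟨a, hx, t, h⟩
    -- The first entries that are kept: those with essential continuations.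
    let A : Set ℕ := {a | ∀ f, ∃ x ∈ D' a, Above f (ζ' x)}
    have hA : A.Infinite := by
      intro hfin
      obtain ⟨b, hb⟩ := hfin.bddAbove
      have : ∀ a, ∃ f, b < a → ∀ x ∈ D' a, ¬ Above f (ζ' x) := by
        intro a
        by_cases h : b < a
        · have : a ∉ A := fun ha => (hb ha).not_gt h
          simp only [A, Set.mem_ofPred_eq] at this
          push Not at this
          obtain ⟨f, hf⟩ := this
          exact ⟨f, fun _ => hf⟩
        · exact ⟨fun _ => 0, fun h' => absurd h' h⟩
      choose f hf using this
      obtain ⟨x, hx, hax⟩ := hpos fun s => match s with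
        | [] => b + 1
        | a :: s => f a s
      obtain ⟨a, ha⟩ := hD x hx
      rw [hζ a x ha, above_cons] at hax
      exact hf a hax.1 x ha hax.2
    let e : ℕ → ℕ := Nat.nth (· ∈ A)
    have he : ∀ j, e j ∈ A := fun j => Nat.nth_mem_of_infinite hA j
    have hmono : StrictMono e := Nat.nth_strictMono hA
    have hsurj : ∀ a ∈ A, ∃ j, e j = a := by
      intro a ha
      classical
      exact ⟨Nat.count (· ∈ A) a, Nat.nth_count ha⟩
    have htree := fun j => ih (D' (e j)) ζ'
      (fun x hx => by
        have := hlen x hx.1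
        rw [hζ _ x hx] at this
        simpa using this)
      (fun x hx y hy hxy => hinj hx.1 hy.1 (by rw [hζ _ x hx, hζ _ y hy, hxy]))
      (he j)
    choose c hunif hpath hmem hcont hbig using htree
    have hroot : ∀ l x, (node c).sub l = some (leaf x) →
        ∃ j m, l = j :: m ∧ (c j).sub m = some (leaf x) := by
      intro l x hl
      cases l with
      | nil => simp at hl
      | cons j m => exact ⟨j, m, rfl, hl⟩
    refine ⟨node c, .node hunif, ?_, ?_, fun U => ?_, fun q U h => ?_⟩
    · intro l m x hl hm
      obtain ⟨i, l, rfl, hl⟩ := hroot l x hl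
      obtain ⟨j, m, rfl, hm⟩ := hroot m x hm
      have hij : i = j := by
        refine hmono.injective ?_
        have h1 := hζ _ x (hmem i l x hl)
        rw [hζ _ x (hmem j m x hm)] at h1
        simp at h1
        exact h1.symm
      subst hij
      rw [hpath i l m x hl hm]
    · intro l x hl
      obtain ⟨j, m, rfl, hl⟩ := hroot l x hl
      exact (hmem j m x hl).1
    · rw [mem_contour_node]
      constructor
      · rintro ⟨b, hb⟩
        have : ∀ a, ∃ f, e b ≤ a → ∀ x ∈ D' a, Above f (ζ' x) → x ∈ U := by
          intro a
          by_cases ha : a ∈ A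
          · obtain ⟨j, rfl⟩ := hsurj a ha
            by_cases hj : b ≤ j
            · obtain ⟨f, hf⟩ := (hcont j U).1 (hb j hj)
              exact ⟨f, fun _ => hf⟩
            · exact ⟨fun _ => 0, fun h' => absurd (hmono.le_iff_le.1 h') hj⟩
          · simp only [A, Set.mem_ofPred_eq] at ha
            push Not at ha
            obtain ⟨f, hf⟩ := ha
            exact ⟨f, fun _ x hx hax => absurd hax (hf x hx)⟩
        choose f hf using this
        refine ⟨fun s => match s with
          | [] => e b
          | a :: s => f a s, fun x hx hax => ?_⟩
        obtain ⟨a, ha⟩ := hD x hx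
        rw [hζ a x ha, above_cons] at hax
        exact hf a hax.1 x ha hax.2
      · rintro ⟨f, hf⟩
        refine ⟨f [], fun j hj => (hcont j U).2 ⟨fun s => f (e j :: s), fun x hx hax => ?_⟩⟩
        refine hf x hx.1 ?_
        rw [hζ _ x hx, above_cons]
        exact ⟨hj.trans hmono.le_apply, hax⟩
    · have hkey : ∀ a p, Big p (tails a (ζ '' {x ∈ U | ∃ l, (node c).sub l = some (leaf x)})) →
          ∃ j, e j = a ∧ Big p ((c j).positions U) := by
        intro a p hp
        obtain ⟨_, x, ⟨-, l, hl⟩, hxa⟩ := hp.nonempty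
        obtain ⟨j, m, rfl, hm⟩ := hroot l x hl
        have hja : e j = a := by
          rw [hζ _ x (hmem j m x hm)] at hxa
          simp at hxa
          exact hxa.1
        refine ⟨j, hja, hbig j p U (hp.mono ?_)⟩
        rintro t ⟨y, ⟨hy, l', hl'⟩, hya⟩
        obtain ⟨i, m', rfl, hm'⟩ := hroot l' y hl'
        rw [hζ _ y (hmem i m' y hm')] at hya
        simp only [List.cons.injEq] at hya
        obtain rfl : i = j := hmono.injective (hya.1.trans hja.symm)
        exact ⟨y, ⟨hy, m', hm'⟩, hya.2⟩
      cases h with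
      | zero h =>
        obtain ⟨_, x, ⟨hx, l, hl⟩, rfl⟩ := h
        exact .zero ⟨l, x, hx, hl⟩
      | tails a h =>
        obtain ⟨j, -, hj⟩ := hkey a q h
        exact .tails j hj
      | @succ p _ A' hA' h =>
        refine .succ (A := {j | Big p ((c j).positions U)}) (fun hfin => hA' ?_) fun j hj => hj
        refine (hfin.image e).subset fun a ha => ?_
        obtain ⟨j, hj, hb⟩ := hkey a p (h a ha)
        exact ⟨j, hb, hj⟩

/-! ### Skies of an ultrafilter -/

/-- Every function of `x` is bounded by `y` on a set of the ultrafilter: in the ultrapower of `ℕ`,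
the element given by `y` belongs to a higher sky than the one given by `x`. -/
def FarBelow (u : Ultrafilter X) (x y : X → ℕ) : Prop :=
  ∀ f : ℕ → ℕ, ∀ᶠ a in (u : Filter X), f (x a) ≤ y a

/-- The function `x` is a function of `z`, and belongs to the same sky. -/
def Represents (u : Ultrafilter X) (x z : X → ℕ) : Prop :=
  (∃ π : ℕ → ℕ, ∀ a, x a = π (z a)) ∧ ∃ f : ℕ → ℕ, ∀ᶠ a in (u : Filter X), z a ≤ f (x a)

/-- The functions in the list are unbounded on each set of the ultrafilter and belong to higher and
higher skies. Comparison with the constant function `0` expresses unboundedness. -/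
def SkyChain (u : Ultrafilter X) (L : List (X → ℕ)) : Prop :=
  ((fun _ => 0) :: L).Pairwise (FarBelow u)

variable {u : Ultrafilter X}

theorem Represents.refl (x : X → ℕ) : Represents u x x :=
  ⟨⟨id, fun _ => rfl⟩, id, .of_forall fun _ => le_rfl⟩

theorem sublistForall₂_represents_refl (L : List (X → ℕ)) :
    List.SublistForall₂ (Represents u) L L := by
  induction L with
  | nil => exact .nil
  | cons x L ih => exact .cons (.refl x) ih

theorem exists_eventually_le_of_not_farBelow {x y : X → ℕ} (h : ¬ FarBelow u x y) :
    ∃ f : ℕ → ℕ, ∀ᶠ a in (u : Filter X), y a ≤ f (x a) := by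
  simp only [FarBelow, not_forall] at h
  obtain ⟨f, hf⟩ := h
  refine ⟨f, (Ultrafilter.eventually_not.2 hf).mono fun a ha => (not_le.1 ha).le⟩

theorem FarBelow.trans {x y z : X → ℕ} (hxy : FarBelow u x y) (hyz : FarBelow u y z) :
    FarBelow u x z := fun f => by
  filter_upwards [hxy f, hyz id] with a h1 h2 using h1.trans h2

theorem FarBelow.mono {x y z : X → ℕ} (hxy : FarBelow u x y) (hyz : ∀ a, y a ≤ z a) :
    FarBelow u x z := fun f => by
  filter_upwards [hxy f] with a h1 using h1.trans (hyz a)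

theorem FarBelow.pair {x y z : X → ℕ} (hxz : FarBelow u x z) {g : ℕ → ℕ}
    (hg : ∀ᶠ a in (u : Filter X), y a ≤ g (x a)) :
    FarBelow u (fun a => Nat.pair (x a) (y a)) z := fun f => by
  filter_upwards [hg, hxz fun c => (Finset.range (g c + 1)).sup fun b => f (Nat.pair c b)]
    with a h1 h2
  exact (Finset.le_sup (f := fun b => f (Nat.pair (x a) b))
    (Finset.mem_range.2 (Nat.lt_succ_of_le h1))).trans h2

theorem represents_pair_left {x y : X → ℕ} {g : ℕ → ℕ}
    (hg : ∀ᶠ a in (u : Filter X), y a ≤ g (x a)) :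
    Represents u x fun a => Nat.pair (x a) (y a) := by
  refine ⟨⟨fun c => (Nat.unpair c).1, fun a => by simp⟩,
    fun c => (Finset.range (g c + 1)).sup fun b => Nat.pair c b, ?_⟩
  filter_upwards [hg] with a h
  exact Finset.le_sup (f := fun b => Nat.pair (x a) b) (Finset.mem_range.2 (Nat.lt_succ_of_le h))

theorem represents_pair_right {x y : X → ℕ} {g : ℕ → ℕ}
    (hg : ∀ᶠ a in (u : Filter X), x a ≤ g (y a)) :
    Represents u y fun a => Nat.pair (x a) (y a) := by
  refine ⟨⟨fun c => (Nat.unpair c).2, fun a => by simp⟩,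
    fun c => (Finset.range (g c + 1)).sup fun b => Nat.pair b c, ?_⟩
  filter_upwards [hg] with a h
  exact Finset.le_sup (f := fun b => Nat.pair b (y a)) (Finset.mem_range.2 (Nat.lt_succ_of_le h))

theorem SkyChain.cons_iff {x : X → ℕ} {L : List (X → ℕ)} :
    SkyChain u (x :: L) ↔ FarBelow u (fun _ => 0) x ∧ (∀ y ∈ L, FarBelow u x y) ∧ SkyChain u L := by
  simp only [SkyChain, List.pairwise_cons, List.mem_cons, forall_eq_or_imp]
  tauto

/-- Two chains merge into one: as skies are linearly ordered, the members can be listed by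
increasing sky, where two members of the same sky are replaced by the pair of them. -/
theorem SkyChain.exists_merge {L M : List (X → ℕ)} (hL : SkyChain u L) (hM : SkyChain u M) :
    ∃ N : List (X → ℕ), SkyChain u N ∧ L.length ≤ N.length ∧ M.length ≤ N.length ∧
      N.length ≤ L.length + M.length ∧
      List.SublistForall₂ (Represents u) L N ∧ List.SublistForall₂ (Represents u) M N ∧
      ∀ z ∈ N, ∃ w ∈ L ++ M, ∀ a, w a ≤ z a := by
  induction L generalizing M with
  | nil =>
    exact ⟨M, hM, by simp, le_rfl, by simp, .nil, sublistForall₂_represents_refl M,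
      fun z hz => ⟨z, by simpa using hz, fun _ => le_rfl⟩⟩
  | cons x L ihL =>
    induction M with
    | nil =>
      exact ⟨x :: L, hL, le_rfl, by simp, by simp, sublistForall₂_represents_refl _, .nil,
        fun z hz => ⟨z, by simpa using hz, fun _ => le_rfl⟩⟩
    | cons y M ihM =>
      obtain ⟨hx0, hxL, hL'⟩ := SkyChain.cons_iff.1 hL
      obtain ⟨hy0, hyM, hM'⟩ := SkyChain.cons_iff.1 hM
      by_cases hxy : FarBelow u x y
      · obtain ⟨N, hN, h1, h2, h3, hLN, hMN, hge⟩ := ihL hL' hM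
        simp only [List.length_cons] at h1 h2 h3 ⊢
        refine ⟨x :: N, SkyChain.cons_iff.2 ⟨hx0, fun z hz => ?_, hN⟩, by simpa using h1,
          by simp; omega, by simp; omega, .cons (.refl x) hLN, .cons_right hMN, fun z hz => ?_⟩
        · obtain ⟨w, hw, hwz⟩ := hge z hz
          refine FarBelow.mono ?_ hwz
          simp only [List.mem_append, List.mem_cons] at hw
          rcases hw with hw | rfl | hw
          · exact hxL w hw
          · exact hxy
          · exact hxy.trans (hyM w hw)
        · rcases List.mem_cons.1 hz with rfl | hz
          · exact ⟨z, by simp, fun _ => le_rfl⟩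
          · obtain ⟨w, hw, hwz⟩ := hge z hz
            exact ⟨w, List.mem_cons_of_mem _ hw, hwz⟩
      · by_cases hyx : FarBelow u y x
        · obtain ⟨N, hN, h1, h2, h3, hLN, hMN, hge⟩ := ihM hM'
          simp only [List.length_cons] at h1 h2 h3 ⊢
          refine ⟨y :: N, SkyChain.cons_iff.2 ⟨hy0, fun z hz => ?_, hN⟩, by simp; omega,
            by simp; omega, by simp; omega, .cons_right hLN, .cons (.refl y) hMN, fun z hz => ?_⟩
          · obtain ⟨w, hw, hwz⟩ := hge z hz
            refine FarBelow.mono ?_ hwz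
            simp only [List.mem_append, List.mem_cons] at hw
            rcases hw with (rfl | hw) | hw
            · exact hyx
            · exact hyx.trans (hxL w hw)
            · exact hyM w hw
          · rcases List.mem_cons.1 hz with rfl | hz
            · exact ⟨z, by simp, fun _ => le_rfl⟩
            · obtain ⟨w, hw, hwz⟩ := hge z hz
              refine ⟨w, ?_, hwz⟩
              simp only [List.mem_append, List.mem_cons] at hw ⊢
              tauto
        · obtain ⟨f, hf⟩ := exists_eventually_le_of_not_farBelow hxy
          obtain ⟨g, hg⟩ := exists_eventually_le_of_not_farBelow hyx
          obtain ⟨N, hN, h1, h2, h3, hLN, hMN, hge⟩ := ihL hL' hM'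
          simp only [List.length_cons] at h1 h2 h3 ⊢
          refine ⟨(fun a => Nat.pair (x a) (y a)) :: N,
            SkyChain.cons_iff.2 ⟨hx0.mono fun a => Nat.left_le_pair _ _, fun z hz => ?_, hN⟩,
            by simp; omega, by simp; omega, by simp; omega, .cons (represents_pair_left hf) hLN,
            .cons (represents_pair_right hg) hMN, fun z hz => ?_⟩
          · obtain ⟨w, hw, hwz⟩ := hge z hz
            refine FarBelow.mono ?_ hwz
            rcases List.mem_append.1 hw with hw | hw
            · exact (hxL w hw).pair hf
            · -- The situation is symmetric up to exchanging the components of the pair.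
              intro F
              have := (hyM w hw).pair hg (fun c => F (Nat.pair (Nat.unpair c).2 (Nat.unpair c).1))
              simpa using this
          · rcases List.mem_cons.1 hz with rfl | hz
            · exact ⟨x, by simp, fun a => Nat.left_le_pair _ _⟩
            · obtain ⟨w, hw, hwz⟩ := hge z hz
              refine ⟨w, ?_, hwz⟩
              simp only [List.mem_append, List.mem_cons] at hw ⊢
              tauto

theorem Above.anti {f g : List ℕ → ℕ} {l : List ℕ} (h : Above g l) (hfg : ∀ s, f s ≤ g s) :
    Above f l := fun i hi => (hfg _).trans (h i hi)

/-- The values of a chain are almost everywhere above any given function of the preceding values,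
since the last of the preceding values bounds all the others. -/
theorem SkyChain.eventually_above {L : List (X → ℕ)} (hL : SkyChain u L) (f : List ℕ → ℕ) :
    ∀ᶠ a in (u : Filter X), Above f (L.map fun x => x a) := by
  suffices h : ∀ (L : List (X → ℕ)) (x : X → ℕ), (x :: L).Pairwise (FarBelow u) →
      ∀ f : ℕ → List ℕ → ℕ, ∀ᶠ a in (u : Filter X), Above (f (x a)) (L.map fun x => x a) from
    h L _ hL fun _ => f
  intro L
  induction L with
  | nil => exact fun x _ f => .of_forall fun a => above_nil _
  | cons y L ih =>
    intro x h f
    have hxy : FarBelow u x y := (List.pairwise_cons.1 h).1 y (by simp)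
    have h' := ih y (List.pairwise_cons.1 h).2
      fun c s => (Finset.range (c + 1)).sup fun b => f b (c :: s)
    filter_upwards [h', hxy fun c => f c [], hxy id] with a h1 h2 h3
    rw [List.map_cons, above_cons]
    exact ⟨h2, h1.anti fun s => Finset.le_sup (f := fun b => f b (y a :: s))
      (Finset.mem_range.2 (Nat.lt_succ_of_le h3))⟩

theorem SkyChain.eventually_sorted {L : List (X → ℕ)} (hL : SkyChain u L) :
    ∀ᶠ a in (u : Filter X), (L.map fun x => x a).Pairwise (· ≤ ·) := by
  induction L with
  | nil => simp
  | cons x L ih =>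
    obtain ⟨-, hx, hL⟩ := SkyChain.cons_iff.1 hL
    have : ∀ᶠ a in (u : Filter X), ∀ y ∈ {y | y ∈ L}, x a ≤ y a :=
      (eventually_all_finite L.finite_toSet).2 fun y hy => hx y hy id
    filter_upwards [ih hL, this] with a h1 h2
    simp only [List.map_cons, List.pairwise_cons, List.mem_map, forall_exists_index, and_imp,
      forall_apply_eq_imp_iff₂]
    exact ⟨h2, h1⟩

/-- Fast growth of the values of `N` forces fast growth of the values of a list that `N`
represents: a small value `x a` bounds the value `z a` of its representative. -/
theorem exists_above_of_sublistForall₂ {L N : List (X → ℕ)}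
    (h : List.SublistForall₂ (Represents u) L N) :
    ∃ D ∈ u, ∀ f, ∃ g, ∀ a ∈ D, Above g (N.map fun x => x a) → Above f (L.map fun x => x a) := by
  induction h with
  | nil => exact ⟨Set.univ, univ_mem, fun f => ⟨f, fun a _ _ => above_nil f⟩⟩
  | @cons x z L N hxz h ih =>
    obtain ⟨D, hD, ih⟩ := ih
    obtain ⟨⟨π, hπ⟩, φ, hφ⟩ := hxz
    refine ⟨D ∩ {a | z a ≤ φ (x a)}, inter_mem hD hφ, fun f => ?_⟩
    choose g hg using fun c => ih fun s => f (π c :: s)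
    refine ⟨fun s => match s with
      | [] => (Finset.range (f [])).sup φ + 1
      | c :: s => g c s, fun a ha => ?_⟩
    simp only [List.map_cons, above_cons]
    rintro ⟨h1, h2⟩
    refine ⟨?_, ?_⟩
    · by_contra! hlt
      have h3 : z a ≤ _ := ha.2.trans (Finset.le_sup (f := φ) (Finset.mem_range.2 hlt))
      omega
    · rw [hπ a]
      exact hg (z a) a ha.1 h2
  | @cons_right z L N h ih =>
    obtain ⟨D, hD, ih⟩ := ih
    refine ⟨D, hD, fun f => ?_⟩
    obtain ⟨g, hg⟩ := ih f
    refine ⟨fun s => g s.tail, fun a ha h => hg a ha ?_⟩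
    rw [List.map_cons, above_cons] at h
    exact h.2

/-- On a set of the ultrafilter, the representation of `L` in `N` holds with exact bounds, and is
given by indices. -/
theorem exists_entry_of_sublistForall₂ {L N : List (X → ℕ)}
    (h : List.SublistForall₂ (Represents u) L N) :
    ∃ D ∈ u, ∀ i : ℕ, ∃ (j : ℕ) (φ π : ℕ → ℕ), ∀ a ∈ D, ∀ c,
      (L.map fun x => x a)[i]? = some c →
        ∃ e, (N.map fun x => x a)[j]? = some e ∧ e ≤ φ c ∧ c = π e := by
  induction h with
  | nil => exact ⟨Set.univ, univ_mem, fun i => ⟨0, id, id, fun a _ c h => by simp at h⟩⟩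
  | @cons x z L N hxz h ih =>
    obtain ⟨D, hD, ih⟩ := ih
    obtain ⟨⟨π, hπ⟩, φ, hφ⟩ := hxz
    refine ⟨D ∩ {a | z a ≤ φ (x a)}, inter_mem hD hφ, fun i => ?_⟩
    cases i with
    | zero =>
      refine ⟨0, φ, π, fun a ha c hc => ⟨z a, by simp, ?_⟩⟩
      simp only [List.map_cons, List.getElem?_cons_zero, Option.some.injEq] at hc
      subst hc
      exact ⟨ha.2, hπ a⟩
    | succ i =>
      obtain ⟨j, φ', π', h'⟩ := ih i
      exact ⟨j + 1, φ', π', fun a ha c hc => by simpa using h' a ha.1 c (by simpa using hc)⟩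
  | @cons_right z L N h ih =>
    obtain ⟨D, hD, ih⟩ := ih
    refine ⟨D, hD, fun i => ?_⟩
    obtain ⟨j, φ', π', h'⟩ := ih i
    exact ⟨j + 1, φ', π', fun a ha c hc => by simpa using h' a ha c hc⟩

theorem finite_bounded_lists (k b : ℕ) : {t : List ℕ | t.length ≤ k ∧ ∀ e ∈ t, e ≤ b}.Finite := by
  induction k with
  | zero =>
    exact (Set.finite_singleton []).subset fun t ht =>
      List.length_eq_zero_iff.1 (by simpa using ht.1)
  | succ k ih =>
    refine ((Set.finite_singleton []).union
      (((Set.finite_Iic b).prod ih).image fun p : ℕ × List ℕ => p.1 :: p.2)).subset ?_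
    rintro t ⟨hl, hb⟩
    cases t with
    | nil => exact .inl rfl
    | cons a t =>
      exact .inr ⟨(a, t), ⟨hb a (by simp), by simpa using hl, fun e he => hb e (by simp [he])⟩, rfl⟩

/-! ### Refining a cascade by the chain of its coordinates -/

theorem mem_maxSet_iff {V : SeqTree X} {x : X} :
    x ∈ V.maxSet ↔ ∃ l, V.sub l = some (leaf x) := by
  constructor
  · rintro ⟨p, rfl⟩
    exact ⟨p.1.1, p.2⟩
  · rintro ⟨l, hl⟩
    exact ⟨⟨(l, x), hl⟩, rfl⟩

/-- The entries of the positions in a monotone cascade of finite rank form a chain of skies for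
every ultrafilter that contains the contour. -/
theorem IsMonotoneSequentialCascade.exists_skyChain {V : SeqTree X}
    (hV : V.IsMonotoneSequentialCascade) {n : ℕ} (hn : V.rank = n)
    (hVu : V.contour.sets ⊆ (u : Filter X).sets) :
    ∃ L : List (X → ℕ), L.length = n ∧ SkyChain u L ∧
      ∃ D ∈ u, ∀ a ∈ D, V.sub (L.map fun x => x a) = some (leaf a) := by
  classical
  let ξ : X → List ℕ := fun a => if h : ∃ l, V.sub l = some (leaf a) then h.choose else []
  have hξ : ∀ l a, V.sub l = some (leaf a) → ξ a = l := by
    intro l a hl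
    have h : ∃ l, V.sub l = some (leaf a) := ⟨l, hl⟩
    simp only [ξ, dif_pos h]
    exact hV.eq_of_sub h.choose_spec hl
  have habove : ∀ f, ∀ᶠ a in (u : Filter X), V.sub (ξ a) = some (leaf a) ∧ Above f (ξ a) := by
    intro f
    refine hVu (mem_contour_iff.2 ⟨f, fun l a hl hf => ?_⟩)
    have := hξ l a hl
    subst this
    exact ⟨hl, hf⟩
  have hlen : ∀ᶠ a in (u : Filter X), V.sub (ξ a) = some (leaf a) ∧ (ξ a).length = n := by
    obtain ⟨f, hf⟩ := hV.exists_above_length hn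
    filter_upwards [habove f] with a ha using ⟨ha.1, hf _ a ha.1 ha.2⟩
  refine ⟨List.ofFn fun (i : Fin n) a => (ξ a).getD i 0, by simp, ?_, _, hlen, ?_⟩
  · rw [SkyChain, List.pairwise_cons, List.pairwise_ofFn]
    constructor
    · intro y hy f
      obtain ⟨i, rfl⟩ := List.mem_ofFn.1 hy
      filter_upwards [hlen, habove fun _ => f 0] with a h1 h2
      have hi : (i : ℕ) < (ξ a).length := h1.2.symm ▸ i.2
      simpa [List.getD_eq_getElem?_getD, hi] using h2.2 i hi
    · intro i j hij f
      filter_upwards [hlen, habove fun s => f (s.getD i 0)] with a h1 h2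
      have hi : (i : ℕ) < (ξ a).length := h1.2.symm ▸ i.2
      have hj : (j : ℕ) < (ξ a).length := h1.2.symm ▸ j.2
      have := h2.2 j hj
      have hij' : (i : ℕ) < j := hij
      simpa [List.getD_eq_getElem?_getD, hi, hj, List.getElem?_take, hij'] using this
  · rintro a ⟨ha, hla⟩
    have : (List.ofFn fun (i : Fin n) (a : X) => (ξ a).getD i 0).map (fun x => x a) = ξ a := by
      refine List.ext_getElem (by simp [hla]) fun i h1 h2 => ?_
      simp [List.getD_eq_getElem?_getD, h2]
    rw [this, ha]

/-- Let `T` be built from the coordinates `ζ`, and let `ξ` give the positions in `V`. If every entry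
of `ξ` is a function of an entry of `ζ`, which is bounded in terms of it, and growth of `ζ` forces
growth of `ξ`, then the contour of `T` contains that of `V`, and `T` increases the order of `V`. -/
theorem contour_subset_and_increasesOrder {V T : SeqTree X}
    (hV : V.IsMonotoneSequentialCascade) {D : Set X} {ξ ζ : X → List ℕ} {n : ℕ}
    (hξ : ∀ a ∈ D, V.sub (ξ a) = some (leaf a)) (hξn : ∀ a, (ξ a).length = n)
    (hsort : ∀ a ∈ D, (ζ a).Pairwise (· ≤ ·))
    (habove : ∀ f, ∃ g, ∀ a ∈ D, Above g (ζ a) → Above f (ξ a))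
    (hentry : ∀ i : ℕ, ∃ (j : ℕ) (φ π : ℕ → ℕ), ∀ a ∈ D, ∀ c, (ξ a)[i]? = some c →
      ∃ e, (ζ a)[j]? = some e ∧ e ≤ φ c ∧ c = π e)
    (hTD : ∀ l a, T.sub l = some (leaf a) → a ∈ D)
    (hTc : ∀ U, U ∈ T.contour ↔ ∃ f, ∀ a ∈ D, Above f (ζ a) → a ∈ U)
    (hTbig : ∀ q U, Big q (ζ '' {a ∈ U | ∃ l, T.sub l = some (leaf a)}) → Big q (T.positions U)) :
    V.contour.sets ⊆ T.contour.sets ∧ T.IncreasesOrder V := by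
  have hTD' : T.maxSet ⊆ D := by
    intro a ha
    obtain ⟨l, hl⟩ := mem_maxSet_iff.1 ha
    exact hTD l a hl
  refine ⟨fun U hU => (hTc U).2 ?_, fun a ha => mem_maxSet_iff.2 ⟨_, hξ a (hTD' ha)⟩,
    fun U hU => ?_⟩
  · obtain ⟨f, hf⟩ := mem_contour_iff.1 hU
    obtain ⟨g, hg⟩ := habove f
    exact ⟨g, fun a ha h => hf _ a (hξ a ha) (hg a ha h)⟩
  · have hUD : U ⊆ D := hU.trans hTD'
    have hpos : V.positions U ⊆ ξ '' U := by
      rintro l ⟨a, ha, hl⟩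
      exact ⟨a, ha, hV.eq_of_sub (hξ a (hUD ha)) hl⟩
    have htransfer : ∀ q, Big q (V.positions U) → Big q (T.positions U) := by
      intro q h
      refine hTbig q U (Big.mono (Big.transfer (h.mono hpos) (ζ := ζ) fun i => ?_) ?_)
      · obtain ⟨j, φ, π, hj⟩ := hentry i
        refine ⟨j + 1, fun c => (finite_bounded_lists (j + 1) (φ c)).subset ?_, ?_⟩
        · -- The entry of index `j` bounds the earlier ones, and `φ c` bounds it.
          rintro t ⟨a, ha, hc, rfl⟩
          obtain ⟨e, he, hec, -⟩ := hj a (hUD ha) c hc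
          refine ⟨by simp, fun e' he' => le_trans ?_ hec⟩
          obtain ⟨i', hi', rfl⟩ := List.mem_iff_getElem.1 he'
          obtain ⟨hj', rfl⟩ := List.getElem?_eq_some_iff.1 he
          rw [List.getElem_take]
          have hi'j : i' ≤ j := by simp at hi'; omega
          rcases hi'j.lt_or_eq with hlt | rfl
          · exact List.pairwise_iff_getElem.1 (hsort a (hUD ha)) _ _ _ _ hlt
          · exact le_rfl
        · intro a ha b hb hab
          by_cases hi : i < n
          · obtain ⟨e, he, -, hae⟩ := hj a (hUD ha) _
              (List.getElem?_eq_getElem ((hξn a).symm ▸ hi))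
            obtain ⟨e', he', -, hbe⟩ := hj b (hUD hb) _
              (List.getElem?_eq_getElem ((hξn b).symm ▸ hi))
            have hee : some e = some e' := by
              have := congrArg (fun t : List ℕ => t[j]?) hab
              simpa [List.getElem?_take, he, he'] using this
            rw [List.getElem?_eq_getElem ((hξn a).symm ▸ hi),
              List.getElem?_eq_getElem ((hξn b).symm ▸ hi), hae, hbe, Option.some.inj hee]
          · rw [List.getElem?_eq_none (by rw [hξn a]; omega),
              List.getElem?_eq_none (by rw [hξn b]; omega)]
      · rintro _ ⟨a, ha, rfl⟩
        exact ⟨a, ⟨ha, mem_maxSet_iff.1 (hU ha)⟩, rfl⟩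
    refine csSup_le' ?_
    rintro β ⟨hβ, hβU⟩
    rcases Ordinal.isPrincipal_add_iff_zero_or_omega0_opow.1 hβ with rfl | ⟨o, rfl⟩
    · exact zero_le
    · -- The positions have length `n`, so that only exponents up to `n` have to be considered.
      have hn : ¬ Big (n + 1) (V.positions U) := by
        intro h
        obtain ⟨_, hl, hle⟩ := h.exists_le_length
        obtain ⟨a, -, rfl⟩ := hpos hl
        rw [hξn a] at hle
        omega
      have ho : o < (n + 1 : ℕ) := (Ordinal.opow_lt_opow_iff_right Ordinal.one_lt_omega0).1
        (hβU.trans_lt (ordType_lt_of_not_big hn))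
      obtain ⟨q, rfl⟩ := Ordinal.lt_omega0.1 (ho.trans (Ordinal.natCast_lt_omega0 _))
      refine le_ordType_of_big (htransfer q ?_)
      by_contra h
      exact (ordType_lt_of_not_big h).not_ge hβU

end SeqTree

theorem theorem3p5 (u : Ultrafilter ℕ) (V W : SeqTree ℕ)
    (hV : V.IsMonotoneSequentialCascade) (hW : W.IsMonotoneSequentialCascade)
    (hVfin : V.rank < Ordinal.omega0) (hWfin : W.rank < Ordinal.omega0)
    (hVu : V.contour.sets ⊆ (u : Filter ℕ).sets) (hWu : W.contour.sets ⊆ (u : Filter ℕ).sets)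
    (n m : ℕ) (hnm : SeqTree.RanksAgree u V n W m) :
    ∃ T : SeqTree ℕ, T.IsMonotoneSequentialCascade ∧
      max V.rank W.rank ≤ T.rank ∧ T.rank ≤ V.rank + W.rank ∧
      T.contour.sets ⊆ (u : Filter ℕ).sets ∧
      T.IncreasesOrder V ∧ T.IncreasesOrder W ∧
      V.contour.sets ⊆ T.contour.sets ∧ W.contour.sets ⊆ T.contour.sets := by
  obtain ⟨v, hv⟩ := Ordinal.lt_omega0.1 hVfin
  obtain ⟨w, hw⟩ := Ordinal.lt_omega0.1 hWfin
  obtain ⟨L, rfl, hL, DV, hDV, hVpos⟩ := hV.exists_skyChain hv hVu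
  obtain ⟨M, rfl, hM, DW, hDW, hWpos⟩ := hW.exists_skyChain hw hWu
  obtain ⟨N, hN, hLN, hMN, hLM, hrepL, hrepM, -⟩ := hL.exists_merge hM
  obtain ⟨D₁, hD₁, habove₁⟩ := SeqTree.exists_above_of_sublistForall₂ hrepL
  obtain ⟨D₂, hD₂, habove₂⟩ := SeqTree.exists_above_of_sublistForall₂ hrepM
  obtain ⟨D₃, hD₃, hentry₁⟩ := SeqTree.exists_entry_of_sublistForall₂ hrepL
  obtain ⟨D₄, hD₄, hentry₂⟩ := SeqTree.exists_entry_of_sublistForall₂ hrepM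
  obtain ⟨D, hD, hsub⟩ : ∃ D ∈ u, ∀ a ∈ D, a ∈ DV ∧ a ∈ DW ∧ a ∈ D₁ ∧ a ∈ D₂ ∧ a ∈ D₃ ∧ a ∈ D₄ ∧
      (N.map fun x => x a).Pairwise (· ≤ ·) := by
    refine ⟨_, ?_, fun a ha => ha⟩
    change ∀ᶠ a in (u : Filter ℕ), _
    filter_upwards [hDV, hDW, hD₁, hD₂, hD₃, hD₄, hN.eventually_sorted] with a h1 h2 h3 h4 h5 h6 h7
    exact ⟨h1, h2, h3, h4, h5, h6, h7⟩
  -- The merged coordinates determine the position in `V`, hence the point.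
  have hinj : Set.InjOn (fun a => N.map fun x => x a) D := by
    intro a ha b hb hab
    have hpos : (L.map fun x => x a) = L.map fun x => x b := by
      refine List.ext_getElem (by simp) fun i hi hi' => ?_
      obtain ⟨j, φ, π, hj⟩ := hentry₁ i
      obtain ⟨e, he, -, hae⟩ := hj a (hsub a ha).2.2.2.2.1 _ (List.getElem?_eq_getElem hi)
      obtain ⟨e', he', -, hbe⟩ := hj b (hsub b hb).2.2.2.2.1 _ (List.getElem?_eq_getElem hi')
      have hee : some e = some e' := by
        rw [← he, ← he']
        exact congrArg (fun t : List ℕ => t[j]?) hab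
      rw [hae, hbe, Option.some.inj hee]
    have h1 := hVpos a (hsub a ha).1
    rw [hpos, hVpos b (hsub b hb).1] at h1
    simpa using h1.symm
  obtain ⟨T, hunif, hpath, hTD, hTc, hTbig⟩ := SeqTree.exists_uniform_of_coordinates N.length D
    (fun a => N.map fun x => x a) (by simp) hinj fun f => by
      obtain ⟨a, ha, haD⟩ := ((hN.eventually_above f).and hD).exists
      exact ⟨a, haD, ha⟩
  obtain ⟨hVc, hVo⟩ := SeqTree.contour_subset_and_increasesOrder hV (D := D)
    (ξ := fun a => L.map fun x => x a) (fun a ha => hVpos a (hsub a ha).1)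
    (fun _ => List.length_map _)
    (fun a ha => (hsub a ha).2.2.2.2.2.2)
    (fun f => (habove₁ f).imp fun g hg a ha => hg a (hsub a ha).2.2.1)
    (fun i => (hentry₁ i).imp fun j h => h.imp fun φ h => h.imp fun π h a ha =>
      h a (hsub a ha).2.2.2.2.1) hTD hTc hTbig
  obtain ⟨hWc, hWo⟩ := SeqTree.contour_subset_and_increasesOrder hW (D := D)
    (ξ := fun a => M.map fun x => x a) (fun a ha => hWpos a (hsub a ha).2.1)
    (fun _ => List.length_map _)
    (fun a ha => (hsub a ha).2.2.2.2.2.2)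
    (fun f => (habove₂ f).imp fun g hg a ha => hg a (hsub a ha).2.2.2.1)
    (fun i => (hentry₂ i).imp fun j h => h.imp fun φ h => h.imp fun π h a ha =>
      h a (hsub a ha).2.2.2.2.2.1) hTD hTc hTbig
  refine ⟨T, hunif.isMonotoneSequentialCascade hpath, ?_, ?_, fun U hU => ?_, hVo, hWo, hVc, hWc⟩
  · rw [hunif.rank_eq, hv, hw]
    exact max_le (by exact_mod_cast hLN) (by exact_mod_cast hMN)
  · rw [hunif.rank_eq, hv, hw]
    exact_mod_cast hLM
  · obtain ⟨f, hf⟩ := (hTc U).1 hU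
    change ∀ᶠ a in (u : Filter ℕ), a ∈ U
    filter_upwards [hD, hN.eventually_above f] with a ha haf using hf a ha haf
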